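/- Let $n\ge 1$, let $f:\{0,1\}^n\to\{0,1\}$ be a boolean function and let $p\in(1/2,1]$. A matchgate is a two-qubit operation that acts as a matrix $A\in SU(2)$ on the span of $|00\rangle,|11\rangle$ and as a matrix $B\in SU(2)$ on the span of $|01\rangle,|10\rangle$ (in these ordered bases). A matchgate circuit on $m$ qubits, arranged on a line, is a finite product of matchgates each acting on two nearest-neighbour qubits. A unitary $U$ on $m\ge n$ qubits computes $f$ with probability at least $p$ if for every $x\in\{0,1\}^n$ a standard basis measurement of the first qubit of $U|x,0^{m-n}\rangle$ yields the outcome $f(x)$ with probability at least $p$; $f$ is matchgate-computable with probability at least $p$ if for some $m\ge n$ there is a matchgate circuit on $m$ qubits that computes $f$ with probability at least $p$. For a bit string $x$ let $\hat x\in\{1,-1\}^n$ be given by $\hat x_i=(-1)^{x_i}$. The function $f$ is a linear threshold gate if there is a representation $(w,\theta)\in\mathbb R^n\times\mathbb R$ of $f$, that is, $f(x)=0$ if and only if $w^T\hat x+\theta>0$. The margin of a representation is $\min_x|w^T\hat x+\theta|$, and the margin $\epsilon$ of $f$ is the maximum of the margins of the representations of $f$ with $\sum_i|w_i|+|\theta|=1$.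 Theorem. The following are equivalent: (a) $f$ is matchgate-computable with probability at least $p$; (b) $f$ is a linear threshold gate with margin $\epsilon\ge 2p-1$. Moreover, (a) holds if and only if there exists a matchgate circuit acting on $m$ qubits, for some $m$ with $n\le m\le n+1$, that computes $f$ with probability at least $p$. -/

import Mathlib

namespace Matchgate

/-- A string of `n` bits; as an index type it labels the standard basis of `n` qubits. -/
abbrev Bits (n : ℕ) : Type := Fin n → Fin 2

/-! ### Linear threshold gates -/

/-- The `±1`-value attached to a bit: `0 ↦ 1` and `1 ↦ -1`. -/
def hat (b : Fin 2) : ℝ := if b = 0 then 1 else -1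

/-- The affine form `wᵀ x̂ + θ`. -/
def affineForm {n : ℕ} (w : Fin n → ℝ) (θ : ℝ) (x : Bits n) : ℝ :=
  (∑ i, w i * hat (x i)) + θ

/-- `(w, θ)` represents `f`: `f x = 0` exactly when `wᵀ x̂ + θ` is strictly positive. -/
def IsRepresentation {n : ℕ} (f : Bits n → Fin 2) (w : Fin n → ℝ) (θ : ℝ) : Prop :=
  ∀ x, f x = 0 ↔ 0 < affineForm w θ x

/-- `f` is a linear threshold gate. -/
def IsLTG {n : ℕ} (f : Bits n → Fin 2) : Prop :=
  ∃ (w : Fin n → ℝ) (θ : ℝ), IsRepresentation f w θ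

/-- `(w, θ)` is normalized: its 1-norm equals 1. -/
def IsNormalized {n : ℕ} (w : Fin n → ℝ) (θ : ℝ) : Prop :=
  (∑ i, |w i|) + |θ| = 1

/-- The margin of a representation: the minimum of `|wᵀ x̂ + θ|` over all bit strings `x`. -/
noncomputable def repMargin {n : ℕ} (w : Fin n → ℝ) (θ : ℝ) : ℝ :=
  Finset.univ.inf' Finset.univ_nonempty fun x : Bits n => |affineForm w θ x|

/-- `ε` is the margin of `f`: the maximal margin of a normalized representation of `f`. -/
def IsMargin {n : ℕ} (f : Bits n → Fin 2) (ε : ℝ) : Prop :=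
  IsGreatest {δ : ℝ | ∃ (w : Fin n → ℝ) (θ : ℝ),
    IsRepresentation f w θ ∧ IsNormalized w θ ∧ δ = repMargin w θ} ε

/-! ### Matchgate circuits -/

/-- The two-qubit operation acting as `A` on the even-parity space (ordered basis `|00⟩, |11⟩`)
and as `B` on the odd-parity space (ordered basis `|01⟩, |10⟩`). -/
def gate (A B : Matrix (Fin 2) (Fin 2) ℂ) : Matrix (Fin 2 × Fin 2) (Fin 2 × Fin 2) ℂ :=
  Matrix.of fun x y =>
    if x.1 = x.2 ∧ y.1 = y.2 then A x.1 y.1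
    else if x.1 ≠ x.2 ∧ y.1 ≠ y.2 then B x.1 y.1
    else 0

/-- The operator on `m` qubits that applies the two-qubit operation `G` to the qubits `j`, `k`
and the identity to all the others. -/
def applyOn {m : ℕ} (j k : Fin m) (G : Matrix (Fin 2 × Fin 2) (Fin 2 × Fin 2) ℂ) :
    Matrix (Bits m) (Bits m) ℂ :=
  Matrix.of fun x y =>
    if ∀ i, i ≠ j → i ≠ k → x i = y i then G (x j, x k) (y j, y k) else 0

/-- The `m`-qubit operators that are a single matchgate (with `A` and `B` in `SU(2)`) acting on
two nearest-neighbour qubits of the line. -/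
def nearestNeighbourGates (m : ℕ) : Set (Matrix (Bits m) (Bits m) ℂ) :=
  {U | ∃ (j k : Fin m) (A B : Matrix (Fin 2) (Fin 2) ℂ), (k : ℕ) = (j : ℕ) + 1 ∧
    A ∈ Matrix.specialUnitaryGroup (Fin 2) ℂ ∧ B ∈ Matrix.specialUnitaryGroup (Fin 2) ℂ ∧
    U = applyOn j k (gate A B)}

/-- `U` is a matchgate circuit: a finite product of nearest-neighbour matchgates. -/
def IsMatchgateCircuit {m : ℕ} (U : Matrix (Bits m) (Bits m) ℂ) : Prop :=
  U ∈ Submonoid.closure (nearestNeighbourGates m)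

/-! ### Computing boolean functions -/

/-- The standard basis vector `|x⟩`. -/
def ket {m : ℕ} (x : Bits m) : Bits m → ℂ := Pi.single x 1

/-- The string `(x, 0)`: `x` followed by `m - n` zeros. -/
def pad {n : ℕ} (m : ℕ) (x : Bits n) : Bits m :=
  fun i => if h : (i : ℕ) < n then x ⟨i, h⟩ else 0

/-- The probability that measuring qubit `q` of the state `ψ` in the standard basis
yields the outcome `b`. -/
noncomputable def outcomeProb {m : ℕ} (q : Fin m) (ψ : Bits m → ℂ) (b : Fin 2) : ℝ :=
  ∑ y with y q = b, ‖ψ y‖ ^ 2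

/-- `U` computes `f` with probability at least `p`: for every `x`, measuring the first qubit of
`U|x, 0⟩` yields `f x` with probability at least `p`. -/
def Computes {n m : ℕ} [NeZero n] (h : n ≤ m) (U : Matrix (Bits m) (Bits m) ℂ)
    (f : Bits n → Fin 2) (p : ℝ) : Prop :=
  ∀ x, p ≤ outcomeProb (Fin.castLE h 0) (U.mulVec (ket (pad m x))) (f x)

/-- `f` is matchgate-computable with probability at least `p`. -/
def IsMatchgateComputable {n : ℕ} [NeZero n] (f : Bits n → Fin 2) (p : ℝ) : Prop :=
  ∃ (m : ℕ) (h : n ≤ m) (U : Matrix (Bits m) (Bits m) ℂ), IsMatchgateCircuit U ∧ Computes h U f p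

end Matchgate

namespace Matchgate

open scoped Matrix ComplexConjugate

/-! Write γ(z) = ∑ Z⋯Z (re zᵢ X + im zᵢ Y). Conjugation by a matchgate maps this real space of
Majorana operators to itself: on two neighbouring qubits, the block of γ(z) from odd to even parity
is a real multiple of an SU(2) matrix up to the sign of one column, and multiplying by SU(2) on
either side preserves that shape. So for a circuit U and the first coordinate vector e, U† turns
γ(e) and γ(ie) into some γ(u) and γ(v) (`IsMatchgateCircuit.exists_intertwines`).

On the first qubit γ(e)γ(ie) = XY = iZ. Hence the expectation of Z in U|x⟩ is Im⟨γ(u)x, γ(v)x⟩ = ∑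
Im(conj uᵢ · vᵢ) x̂ᵢ, an affine form in the input once the ancillas, fixed to 0, are collected into
θ (`outcomeProb_eq`). As u and v are unit vectors, its 1-norm is at most 1. Success with probability
p thus says that the form, with the sign prescribed by f, is at least 2p - 1 > 0. Rescaling and
compactness turn this into a statement about the margin (`exists_isMargin`).

Conversely, weights W of 1-norm 1 come from uᵢ = √|Wᵢ| and vᵢ = ±i√|Wᵢ|. A cascade of rotations
spreads e and ie into these vectors (`exists_circuit`), and a single ancilla carries θ. -/

/-! ### Gates as operators on state vectors -/

/-- The string `x` with the bit `i` flipped. -/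
def flip {m : ℕ} (i : Fin m) (x : Bits m) : Bits m := Function.update x i (x i + 1)

theorem applyOn_mulVec {m : ℕ} {j k : Fin m} (hjk : j ≠ k)
    (G : Matrix (Fin 2 × Fin 2) (Fin 2 × Fin 2) ℂ) (ψ : Bits m → ℂ) (x : Bits m) :
    (applyOn j k G *ᵥ ψ) x =
      ∑ b, ∑ c, G (x j, x k) (b, c) * ψ (Function.update (Function.update x j b) k c) := by
  have hval : ∀ b c : Fin 2, (Function.update (Function.update x j b) k c) j = b ∧
      (Function.update (Function.update x j b) k c) k = c := by
    intro b c; simp [hjk]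
  rw [← Fintype.sum_prod_type'
    (f := fun b c => G (x j, x k) (b, c) * ψ (Function.update (Function.update x j b) k c))]
  simp only [Matrix.mulVec, dotProduct, applyOn, Matrix.of_apply, ite_mul, zero_mul]
  rw [← Finset.sum_filter]
  symm
  refine Finset.sum_bij' (fun q _ => Function.update (Function.update x j q.1) k q.2)
    (fun y _ => (y j, y k)) ?_ ?_ ?_ ?_ ?_
  · intro q _
    simp only [Finset.mem_filter, Finset.mem_univ, true_and]
    intro i h1 h2
    simp [h1, h2]
  · simp
  · intro q _
    simp [hjk]
  · intro y hy
    simp only [Finset.mem_filter, Finset.mem_univ, true_and] at hy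
    ext1 i
    by_cases h2 : i = k
    · subst h2; simp
    · by_cases h1 : i = j
      · subst h1; simp [h2]
      · simp [h1, h2, hy i h1 h2]
  · intro q _
    simp [hjk]

theorem applyOn_mul {m : ℕ} {j k : Fin m} (hjk : j ≠ k)
    (G H : Matrix (Fin 2 × Fin 2) (Fin 2 × Fin 2) ℂ) :
    applyOn j k G * applyOn j k H = applyOn j k (G * H) := by
  ext x y
  have h := applyOn_mulVec hjk G (fun w => applyOn j k H w y) x
  simp only [Matrix.mulVec, dotProduct] at h
  rw [Matrix.mul_apply, h]
  simp only [applyOn, Matrix.of_apply]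
  by_cases hxy : ∀ i, i ≠ j → i ≠ k → x i = y i
  · rw [if_pos hxy, Matrix.mul_apply, Fintype.sum_prod_type]
    refine Finset.sum_congr rfl fun b _ => Finset.sum_congr rfl fun c _ => ?_
    rw [if_pos]
    · simp [hjk]
    · intro i h1 h2; simp [h1, h2, hxy i h1 h2]
  · rw [if_neg hxy]
    refine Finset.sum_eq_zero fun b _ => Finset.sum_eq_zero fun c _ => ?_
    rw [if_neg, mul_zero]
    intro h'
    apply hxy
    intro i h1 h2
    simpa [h1, h2] using h' i h1 h2

theorem applyOn_one {m : ℕ} (j k : Fin m) : applyOn j k 1 = 1 := by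
  ext x y
  simp only [applyOn, Matrix.of_apply, Matrix.one_apply, Prod.mk.injEq]
  by_cases hxy : x = y
  · subst hxy; simp
  · rw [if_neg hxy]
    by_cases h : ∀ i, i ≠ j → i ≠ k → x i = y i
    · rw [if_pos h, if_neg]
      rintro ⟨h1, h2⟩
      apply hxy
      ext1 i
      by_cases hj : i = j
      · rw [hj, h1]
      · by_cases hk : i = k
        · rw [hk, h2]
        · exact h i hj hk
    · rw [if_neg h]

theorem applyOn_conjTranspose {m : ℕ} (j k : Fin m)
    (G : Matrix (Fin 2 × Fin 2) (Fin 2 × Fin 2) ℂ) :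
    (applyOn j k G)ᴴ = applyOn j k Gᴴ := by
  ext x y
  have : (∀ i, i ≠ j → i ≠ k → y i = x i) ↔ ∀ i, i ≠ j → i ≠ k → x i = y i := by
    simp only [eq_comm]
  simp only [applyOn, Matrix.of_apply, Matrix.conjTranspose_apply, this]
  split_ifs <;> simp

theorem gate_conjTranspose (A B : Matrix (Fin 2) (Fin 2) ℂ) : (gate A B)ᴴ = gate Aᴴ Bᴴ := by
  ext x y
  simp only [gate, Matrix.of_apply, Matrix.conjTranspose_apply, ne_eq,
    and_comm (a := y.1 = y.2), and_comm (a := ¬ y.1 = y.2)]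
  split_ifs <;> simp

theorem gate_mul (A B C D : Matrix (Fin 2) (Fin 2) ℂ) :
    gate A B * gate C D = gate (A * C) (B * D) := by
  ext ⟨x₁, x₂⟩ ⟨y₁, y₂⟩
  fin_cases x₁ <;> fin_cases x₂ <;> fin_cases y₁ <;> fin_cases y₂ <;>
    simp [gate, Matrix.mul_apply, Fintype.sum_prod_type]

theorem gate_one : gate 1 1 = 1 := by
  ext ⟨x₁, x₂⟩ ⟨y₁, y₂⟩
  fin_cases x₁ <;> fin_cases x₂ <;> fin_cases y₁ <;> fin_cases y₂ <;>
    simp [gate, Matrix.one_apply]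

theorem applyOn_gate_conjTranspose_mul_self {m : ℕ} {j k : Fin m} (hjk : j ≠ k)
    {A B : Matrix (Fin 2) (Fin 2) ℂ} (hA : Aᴴ * A = 1) (hB : Bᴴ * B = 1) :
    (applyOn j k (gate A B))ᴴ * applyOn j k (gate A B) = 1 := by
  rw [applyOn_conjTranspose, applyOn_mul hjk, gate_conjTranspose, gate_mul, hA, hB, gate_one,
    applyOn_one]

theorem conjTranspose_mul_self_of_mem_SU {A : Matrix (Fin 2) (Fin 2) ℂ}
    (hA : A ∈ Matrix.specialUnitaryGroup (Fin 2) ℂ) : Aᴴ * A = 1 := by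
  have := (Matrix.mem_specialUnitaryGroup_iff.1 hA).1
  exact Matrix.mem_unitaryGroup_iff'.1 this

theorem IsMatchgateCircuit.conjTranspose_mul_self {m : ℕ} {U : Matrix (Bits m) (Bits m) ℂ}
    (hU : IsMatchgateCircuit U) : Uᴴ * U = 1 := by
  induction hU using Submonoid.closure_induction with
  | mem U h =>
    obtain ⟨j, k, A, B, hk, hA, hB, rfl⟩ := h
    have hjk : j ≠ k := by rintro rfl; omega
    exact applyOn_gate_conjTranspose_mul_self hjk (conjTranspose_mul_self_of_mem_SU hA)
      (conjTranspose_mul_self_of_mem_SU hB)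
  | one => simp
  | mul U V _ _ hU hV =>
    rw [Matrix.conjTranspose_mul, Matrix.mul_assoc, ← Matrix.mul_assoc Uᴴ, hU, Matrix.one_mul, hV]

/-! ### Majorana operators in the Jordan–Wigner representation -/

/-- The Jordan–Wigner sign of the site `i`: the parity of the bits to the left of `i`. -/
noncomputable def jwSign {m : ℕ} (i : Fin m) (x : Bits m) : ℂ :=
  ∏ l with l < i, (hat (x l) : ℂ)

/-- The number `conj z` or `z`, according to the bit `b`. -/
def bitConj (b : Fin 2) (z : ℂ) : ℂ := if b = 0 then conj z else z

/-- The Majorana operator `∑ i, Z ⋯ Z (re zᵢ X + im zᵢ Y)` applied to the state `ψ`. -/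
noncomputable def majorana {m : ℕ} (z : Fin m → ℂ) (ψ : Bits m → ℂ) (x : Bits m) : ℂ :=
  ∑ i, jwSign i x * bitConj (x i) (z i) * ψ (flip i x)

/-- Conjugation by `U` turns the Majorana operator of `z` into that of `z'`. -/
def Intertwines {m : ℕ} (U : Matrix (Bits m) (Bits m) ℂ) (z z' : Fin m → ℂ) : Prop :=
  ∀ ψ, majorana z (U *ᵥ ψ) = U *ᵥ majorana z' ψ

theorem Intertwines.one {m : ℕ} (z : Fin m → ℂ) : Intertwines 1 z z := by
  intro ψ; simp

/-- Heisenberg picture: the leftmost factor, which acts last on the state, is the first to transform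
the coefficients. -/
theorem Intertwines.mul {m : ℕ} {U V : Matrix (Bits m) (Bits m) ℂ} {z z' z'' : Fin m → ℂ}
    (hU : Intertwines U z z') (hV : Intertwines V z' z'') : Intertwines (U * V) z z'' := by
  intro ψ
  rw [← Matrix.mulVec_mulVec, hU, hV, Matrix.mulVec_mulVec]

/-- The block, from odd to even parity, of a Majorana operator on two neighbouring qubits. -/
def oddBlock (p q : ℂ) : Matrix (Fin 2) (Fin 2) ℂ := !![conj q, conj p; p, -q]

theorem jwSign_succ {m : ℕ} {j k : Fin m} (hk : (k : ℕ) = j + 1) (x : Bits m) :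
    jwSign k x = jwSign j x * hat (x j) := by
  have : (Finset.univ.filter fun l : Fin m => l < k)
      = insert j (Finset.univ.filter fun l : Fin m => l < j) := by
    ext l
    simp only [Finset.mem_filter, Finset.mem_univ, true_and, Finset.mem_insert, Fin.lt_def,
      Fin.ext_iff]
    omega
  rw [jwSign, this, Finset.prod_insert (by simp), mul_comm, jwSign]

theorem jwSign_update_of_le {m : ℕ} {i j : Fin m} (h : i ≤ j) (x : Bits m) (b : Fin 2) :
    jwSign i (Function.update x j b) = jwSign i x := by
  refine Finset.prod_congr rfl fun l hl => ?_
  have : l ≠ j := by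
    rintro rfl
    simp at hl
    exact absurd hl (not_lt.2 h)
  simp [this]

/-- Beyond `k` the sign sees the bits `j` and `k` only through their joint parity, which matchgates
preserve. -/
theorem jwSign_update_update_of_lt {m : ℕ} {i j k : Fin m} (hjk : j < k) (hi : k < i)
    (x : Bits m) {b c : Fin 2} (h : hat b * hat c = hat (x j) * hat (x k)) :
    jwSign i (Function.update (Function.update x j b) k c) = jwSign i x := by
  have hj : j ∈ Finset.univ.filter fun l : Fin m => l < i := by simp [hjk.trans hi]
  have hk : k ∈ (Finset.univ.filter fun l : Fin m => l < i).erase j := by simp [hi, hjk.ne']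
  have h' : (hat b : ℂ) * hat c = hat (x j) * hat (x k) := by exact_mod_cast h
  unfold jwSign
  rw [← Finset.mul_prod_erase _ _ hj, ← Finset.mul_prod_erase _ _ hk,
    ← Finset.mul_prod_erase _ _ hj, ← Finset.mul_prod_erase _ _ hk, ← mul_assoc, ← mul_assoc]
  simp only [Function.update_self, Function.update_of_ne hjk.ne]
  rw [h']
  congr 1
  refine Finset.prod_congr rfl fun l hl => ?_
  simp only [Finset.mem_erase] at hl
  simp [hl.1, hl.2.1]

theorem hat_mul_hat_of_gate_ne_zero {A B : Matrix (Fin 2) (Fin 2) ℂ} {x y : Fin 2 × Fin 2}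
    (h : gate A B x y ≠ 0) : hat y.1 * hat y.2 = hat x.1 * hat x.2 := by
  obtain ⟨x₁, x₂⟩ := x
  obtain ⟨y₁, y₂⟩ := y
  revert h
  fin_cases x₁ <;> fin_cases x₂ <;> fin_cases y₁ <;> fin_cases y₂ <;> simp [gate, hat]

theorem flip_update_update {m : ℕ} {i j k : Fin m} (hj : i ≠ j) (hk : i ≠ k) (x : Bits m)
    (b c : Fin 2) :
    flip i (Function.update (Function.update x j b) k c)
      = Function.update (Function.update (flip i x) j b) k c := by
  ext1 l
  simp only [flip, Function.update_apply]
  split_ifs <;> simp_all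

/-- The two-qubit identity behind the intertwining relation. -/
theorem gate_oddBlock {A B : Matrix (Fin 2) (Fin 2) ℂ} {p q p' q' : ℂ}
    (h : oddBlock p q * B = A * oddBlock p' q')
    (h' : (oddBlock p q)ᴴ * A = B * (oddBlock p' q')ᴴ) (F : Fin 2 → Fin 2 → ℂ) (s t : Fin 2) :
    bitConj s p * (∑ b, ∑ c, gate A B (s + 1, t) (b, c) * F b c)
        + hat s * bitConj t q * (∑ b, ∑ c, gate A B (s, t + 1) (b, c) * F b c)
      = ∑ b, ∑ c, gate A B (s, t) (b, c) *
        (bitConj b p' * F (b + 1) c + hat b * bitConj c q' * F b (c + 1)) := by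
  have e := fun i j => congrFun (congrFun h i) j
  have e' := fun i j => congrFun (congrFun h' i) j
  have e00 := e 0 0
  have e01 := e 0 1
  have e10 := e 1 0
  have e11 := e 1 1
  have f00 := e' 0 0
  have f01 := e' 0 1
  have f10 := e' 1 0
  have f11 := e' 1 1
  clear e e' h h'
  simp [Matrix.mul_apply, oddBlock] at e00 e01 e10 e11 f00 f01 f10 f11
  have h2 : (1 + 1 : Fin 2) = 0 := rfl
  -- The even rows 00 and 11 use the odd-to-even block `h`; the odd rows 01 and 10 use its adjoint
  -- version `h'`.
  fin_cases s <;> fin_cases t <;> simp [gate, hat, bitConj, h2]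
  · linear_combination e00 * F 0 1 + e01 * F 1 0
  · linear_combination f00 * F 0 0 + f01 * F 1 1
  · linear_combination f10 * F 0 0 + f11 * F 1 1
  · linear_combination e10 * F 0 1 + e11 * F 1 0

/-- The Majorana terms at `j` and `k` share the factor `jwSign j` and reduce to `gate_oddBlock`.
Every other term commutes with the gate by itself, since its string crosses both qubits or neither
and the gate preserves parity. -/
theorem intertwines_gate {m : ℕ} {j k : Fin m} (hk : (k : ℕ) = j + 1)
    {A B : Matrix (Fin 2) (Fin 2) ℂ} {z z' : Fin m → ℂ}
    (hz : ∀ i, i ≠ j → i ≠ k → z' i = z i)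
    (h : oddBlock (z j) (z k) * B = A * oddBlock (z' j) (z' k))
    (h' : (oddBlock (z j) (z k))ᴴ * A = B * (oddBlock (z' j) (z' k))ᴴ) :
    Intertwines (applyOn j k (gate A B)) z z' := by
  intro ψ
  ext1 x
  have hlt : j < k := by rw [Fin.lt_def]; omega
  have hjk : j ≠ k := hlt.ne
  have split : ∀ g : Fin m → ℂ,
      ∑ i, g i = g j + g k + ∑ i ∈ (Finset.univ.erase j).erase k, g i := by
    intro g
    rw [← Finset.add_sum_erase _ _ (Finset.mem_univ j),
      ← Finset.add_sum_erase _ _ (Finset.mem_erase.2 ⟨hjk.symm, Finset.mem_univ k⟩), add_assoc]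
  rw [applyOn_mulVec hjk]
  simp only [majorana]
  simp_rw [split, mul_add _ _ (Finset.sum _ _), Finset.sum_add_distrib]
  congr 1
  · have key := congrArg (jwSign j x * ·) (gate_oddBlock h h'
      (fun b c => ψ (Function.update (Function.update x j b) k c)) (x j) (x k))
    simp only [Finset.mul_sum, mul_add] at key
    simp only [applyOn_mulVec hjk, jwSign_succ hk]
    have f1 : ∀ b c, Function.update (Function.update (flip j x) j b) k c
        = Function.update (Function.update x j b) k c := by
      intro b c; simp [flip]
    have f2 : ∀ b c, Function.update (Function.update (flip k x) j b) k c
        = Function.update (Function.update x j b) k c := by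
      intro b c; ext1 l; simp only [flip, Function.update_apply]; split_ifs <;> rfl
    have f3 : ∀ b c, flip j (Function.update (Function.update x j b) k c)
        = Function.update (Function.update x j (b + 1)) k c := by
      intro b c; ext1 l; simp only [flip, Function.update_apply]; split_ifs <;> simp_all
    have f4 : ∀ b c, flip k (Function.update (Function.update x j b) k c)
        = Function.update (Function.update x j b) k (c + 1) := by
      intro b c; simp [flip]
    have f5 : ∀ b c, jwSign j (Function.update (Function.update x j b) k c) = jwSign j x := by
      intro b c
      rw [jwSign_update_of_le hlt.le, jwSign_update_of_le le_rfl]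
    simp only [f1, f2, f3, f4, f5]
    simp only [flip, Function.update_self, Function.update_of_ne hjk,
      Function.update_of_ne hjk.symm, Finset.mul_sum, mul_add, Finset.sum_add_distrib]
      at key ⊢
    calc _ = _ := ?_
      _ = _ := key
      _ = _ := ?_
    · congr 1 <;> refine Finset.sum_congr rfl fun b _ => Finset.sum_congr rfl fun c _ => ?_ <;>
        ring
    · congr 1 <;> refine Finset.sum_congr rfl fun b _ => Finset.sum_congr rfl fun c _ => ?_ <;>
        ring
  · simp only [Finset.mul_sum]
    rw [Finset.sum_congr rfl fun b _ => Finset.sum_comm, Finset.sum_comm]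
    refine Finset.sum_congr rfl fun i hi => ?_
    simp only [Finset.mem_erase, Finset.mem_univ, and_true] at hi
    obtain ⟨hik, hij⟩ := hi
    rw [applyOn_mulVec hjk, Finset.mul_sum]
    refine Finset.sum_congr rfl fun b _ => ?_
    rw [Finset.mul_sum]
    refine Finset.sum_congr rfl fun c _ => ?_
    rw [flip_update_update hij hik, hz i hij hik]
    have e1 : flip i x j = x j := Function.update_of_ne hij.symm _ _
    have e2 : flip i x k = x k := Function.update_of_ne hik.symm _ _
    have e3 : (Function.update (Function.update x j b) k c) i = x i := by simp [hij, hik]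
    rw [e1, e2, e3]
    by_cases h0 : gate A B (x j, x k) (b, c) = 0
    · simp [h0]
    · have : jwSign i (Function.update (Function.update x j b) k c) = jwSign i x := by
        rcases lt_or_gt_of_ne hij with h1 | h1
        · rw [jwSign_update_of_le (h1.trans hlt).le, jwSign_update_of_le h1.le]
        · refine jwSign_update_update_of_lt hlt ?_ x (hat_mul_hat_of_gate_ne_zero h0)
          have : (i : ℕ) ≠ k := fun h => hik (Fin.ext h)
          rw [Fin.lt_def] at h1 ⊢
          omega
      rw [this]
      ring

/-- Unitarity of the blocks solves both relations of `intertwines_gate` for the new coefficients;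
the second is the adjoint of the first. -/
theorem intertwines_gate_of_eq {m : ℕ} {j k : Fin m} (hk : (k : ℕ) = j + 1)
    {A B : Matrix (Fin 2) (Fin 2) ℂ} (hA : Aᴴ * A = 1) (hB : Bᴴ * B = 1) {z z' : Fin m → ℂ}
    (hz : ∀ i, i ≠ j → i ≠ k → z' i = z i)
    (h : oddBlock (z' j) (z' k) = Aᴴ * oddBlock (z j) (z k) * B) :
    Intertwines (applyOn j k (gate A B)) z z' := by
  have hA' : A * Aᴴ = 1 := mul_eq_one_comm.1 hA
  have hB' : B * Bᴴ = 1 := mul_eq_one_comm.1 hB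
  refine intertwines_gate hk hz ?_ ?_
  · rw [h, Matrix.mul_assoc, ← Matrix.mul_assoc, hA', Matrix.one_mul]
  · rw [h]
    simp only [Matrix.conjTranspose_mul, Matrix.conjTranspose_conjTranspose]
    rw [← Matrix.mul_assoc, hB', Matrix.one_mul]

/-- A special unitary matrix of size two is determined by its first column. -/
theorem eq_of_mem_SU {A : Matrix (Fin 2) (Fin 2) ℂ}
    (hA : A ∈ Matrix.specialUnitaryGroup (Fin 2) ℂ) :
    A = !![A 0 0, -conj (A 1 0); A 1 0, conj (A 0 0)] := by
  have h1 := conjTranspose_mul_self_of_mem_SU hA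
  have h2 : A.det = 1 := (Matrix.mem_specialUnitaryGroup_iff.1 hA).2
  have h3 : A.adjugate = Aᴴ := by
    -- Determinant one makes the adjugate the inverse, hence the adjoint.
    have : Aᴴ * (A * A.adjugate) = Aᴴ := by rw [Matrix.mul_adjugate, h2]; simp
    rw [← Matrix.mul_assoc, h1, Matrix.one_mul] at this
    exact this
  rw [Matrix.adjugate_fin_two] at h3
  have e0 := congrFun (congrFun h3 0) 0
  have e1 := congrFun (congrFun h3 0) 1
  simp at e0 e1
  ext i l
  fin_cases i <;> fin_cases l <;> simp
  · rw [← e1]; simp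
  · exact e0

theorem exists_intertwines_gate {m : ℕ} {j k : Fin m} (hk : (k : ℕ) = j + 1)
    {A B : Matrix (Fin 2) (Fin 2) ℂ} (hA : A ∈ Matrix.specialUnitaryGroup (Fin 2) ℂ)
    (hB : B ∈ Matrix.specialUnitaryGroup (Fin 2) ℂ) (z : Fin m → ℂ) :
    ∃ z', Intertwines (applyOn j k (gate A B)) z z' := by
  have hjk : j ≠ k := by rintro rfl; omega
  set M := Aᴴ * oddBlock (z j) (z k) * B with hM
  -- The second row of `oddBlock p q` is `(p, -q)`, so it dictates the new coefficients. The first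
  -- row then agrees because `A` and `B` have the SU(2) shape.
  refine ⟨Function.update (Function.update z j (M 1 0)) k (-M 1 1),
    intertwines_gate_of_eq hk (conjTranspose_mul_self_of_mem_SU hA)
      (conjTranspose_mul_self_of_mem_SU hB) ?_ ?_⟩
  · intro i h1 h2; simp [h1, h2]
  · rw [← hM]
    simp only [Function.update_self, Function.update_of_ne hjk]
    rw [eq_of_mem_SU hA, eq_of_mem_SU hB] at hM
    ext i l
    fin_cases i <;> fin_cases l <;>
      simp [hM, oddBlock, Matrix.mul_apply, Fin.sum_univ_two] <;> ring

theorem IsMatchgateCircuit.exists_intertwines {m : ℕ} {U : Matrix (Bits m) (Bits m) ℂ}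
    (hU : IsMatchgateCircuit U) (z : Fin m → ℂ) : ∃ z', Intertwines U z z' := by
  induction hU using Submonoid.closure_induction generalizing z with
  | mem U h =>
    obtain ⟨j, k, A, B, hk, hA, hB, rfl⟩ := h
    exact exists_intertwines_gate hk hA hB z
  | one => exact ⟨z, Intertwines.one z⟩
  | mul U V _ _ hU hV =>
    obtain ⟨z', h1⟩ := hU z
    obtain ⟨z'', h2⟩ := hV z'
    exact ⟨z'', h1.mul h2⟩

/-! ### Expectation values -/

theorem flip_flip {m : ℕ} (i : Fin m) (x : Bits m) : flip i (flip i x) = x := by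
  have h : ∀ b : Fin 2, b + 1 + 1 = b := by decide
  simp [flip, h]

theorem flip_apply_self {m : ℕ} (i : Fin m) (x : Bits m) : flip i x i = x i + 1 := by
  simp [flip]

theorem flip_injective {m : ℕ} (x : Bits m) : Function.Injective fun i => flip i x := by
  intro i l h
  by_contra hne
  have h1 := congrFun h i
  simp only [flip, Function.update_self, Function.update_of_ne hne] at h1
  have : ∀ b : Fin 2, b + 1 ≠ b := by decide
  exact this _ h1

theorem conj_jwSign_mul_self {m : ℕ} (i : Fin m) (x : Bits m) :
    conj (jwSign i x) * jwSign i x = 1 := by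
  rw [jwSign, map_prod, ← Finset.prod_mul_distrib]
  refine Finset.prod_eq_one fun l _ => ?_
  unfold hat
  split_ifs <;> simp

theorem majorana_ket {m : ℕ} (z : Fin m → ℂ) (x : Bits m) :
    majorana z (ket x)
      = ∑ i, (jwSign i (flip i x) * bitConj (x i + 1) (z i)) • ket (flip i x) := by
  ext1 y
  simp only [majorana, Finset.sum_apply, Pi.smul_apply, smul_eq_mul]
  refine Finset.sum_congr rfl fun i _ => ?_
  by_cases h : y = flip i x
  · subst h
    simp [flip_flip, flip_apply_self, ket]
  · have h' : flip i y ≠ x := by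
      rintro rfl
      exact h (flip_flip i y).symm
    simp [ket, h, h']

theorem dotProduct_sum_ket {m : ℕ} {ι : Type*} [Fintype ι] [DecidableEq ι] {g : ι → Bits m}
    (hg : Function.Injective g) (c d : ι → ℂ) :
    star (∑ i, c i • ket (g i)) ⬝ᵥ (∑ i, d i • ket (g i)) = ∑ i, conj (c i) * d i := by
  rw [star_sum, sum_dotProduct]
  refine Finset.sum_congr rfl fun i _ => ?_
  rw [dotProduct_sum, Finset.sum_eq_single i]
  · simp [ket, mul_comm]
  · intro l _ hl
    have : g l ≠ g i := fun h => hl (hg h)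
    simp [ket, this.symm]
  · simp

/-- Flips at different sites give orthogonal basis vectors, so only diagonal terms survive, and the
Jordan–Wigner signs cancel in them. -/
theorem dotProduct_majorana_ket {m : ℕ} (u v : Fin m → ℂ) (x : Bits m) :
    star (majorana u (ket x)) ⬝ᵥ majorana v (ket x)
      = ∑ i, conj (bitConj (x i + 1) (u i)) * bitConj (x i + 1) (v i) := by
  rw [majorana_ket, majorana_ket, dotProduct_sum_ket (flip_injective x)]
  refine Finset.sum_congr rfl fun i _ => ?_
  rw [map_mul, mul_mul_mul_comm, conj_jwSign_mul_self, one_mul]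

theorem dotProduct_mulVec_of_isometry {m : ℕ} {U : Matrix (Bits m) (Bits m) ℂ} (hU : Uᴴ * U = 1)
    (φ ψ : Bits m → ℂ) : star (U *ᵥ φ) ⬝ᵥ (U *ᵥ ψ) = star φ ⬝ᵥ ψ := by
  rw [Matrix.star_mulVec, Matrix.dotProduct_mulVec, Matrix.vecMul_vecMul, hU, Matrix.vecMul_one]

theorem jwSign_first {m : ℕ} {q : Fin m} (hq : (q : ℕ) = 0) (x : Bits m) : jwSign q x = 1 := by
  refine Finset.prod_eq_one fun l hl => ?_
  simp [Fin.lt_def, hq] at hl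

theorem majorana_single {m : ℕ} {q : Fin m} (hq : (q : ℕ) = 0) (a : ℂ) (ψ : Bits m → ℂ)
    (x : Bits m) : majorana (Pi.single q a) ψ x = bitConj (x q) a * ψ (flip q x) := by
  rw [majorana, Finset.sum_eq_single q]
  · simp [jwSign_first hq]
  · intro i _ hi
    simp [hi, bitConj]
  · simp

theorem sum_flip {m : ℕ} {M : Type*} [AddCommMonoid M] (q : Fin m) (g : Bits m → M) :
    ∑ y, g (flip q y) = ∑ y, g y :=
  Equiv.sum_comp (Function.Involutive.toPerm (flip q) (flip_flip q)) g

theorem dotProduct_majorana_single {m : ℕ} {q : Fin m} (hq : (q : ℕ) = 0) (a b : ℂ)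
    (ψ : Bits m → ℂ) :
    star (majorana (Pi.single q a) ψ) ⬝ᵥ majorana (Pi.single q b) ψ
      = ∑ y, conj (bitConj (y q + 1) a) * bitConj (y q + 1) b * (‖ψ y‖ ^ 2 : ℝ) := by
  rw [← sum_flip q]
  refine Finset.sum_congr rfl fun y _ => ?_
  have h : ∀ b : Fin 2, b + 1 + 1 = b := by decide
  simp only [Pi.star_apply, majorana_single hq, flip_apply_self, h]
  rw [Complex.ofReal_pow, ← Complex.conj_mul']
  simp
  ring

/-- The weight of `Z i` in the product of the Majorana operators of `u` and `v`. -/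
noncomputable def weight {m : ℕ} (u v : Fin m → ℂ) (i : Fin m) : ℝ := (conj (u i) * v i).im

/-- Both sides are the squared norm of one vector: the Majorana operator of `u` scales a basis
vector to squared norm ∑ ‖uᵢ‖², while the one on the first qubit, with ‖a‖ = 1, preserves norms. -/
theorem sum_norm_sq_of_intertwines {m : ℕ} {q : Fin m} (hq : (q : ℕ) = 0)
    {U : Matrix (Bits m) (Bits m) ℂ} (hU : Uᴴ * U = 1) {a : ℂ} (ha : ‖a‖ = 1) {u : Fin m → ℂ}
    (h : Intertwines U (Pi.single q a) u) : ∑ i, ‖u i‖ ^ 2 = 1 := by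
  have hb : ∀ (b : Fin 2) (z : ℂ), conj (bitConj b z) * bitConj b z = ((‖z‖ ^ 2 : ℝ) : ℂ) := by
    intro b z
    rw [Complex.conj_mul']
    unfold bitConj
    split_ifs <;> simp
  have h1 := dotProduct_majorana_single hq a a (U *ᵥ ket 0)
  rw [h, dotProduct_mulVec_of_isometry hU, dotProduct_majorana_ket] at h1
  simp only [hb, ha] at h1
  have h2 := dotProduct_mulVec_of_isometry hU (ket 0) (ket 0)
  have h3 : star (ket (0 : Bits m)) ⬝ᵥ ket 0 = 1 := by simp [ket]
  rw [h3, dotProduct] at h2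
  have h4 : ∀ y, star (U *ᵥ ket 0) y * (U *ᵥ ket 0) y = ((‖(U *ᵥ ket 0) y‖ ^ 2 : ℝ) : ℂ) := by
    intro y
    rw [Pi.star_apply, Complex.ofReal_pow, ← Complex.conj_mul']
    rfl
  simp only [h4] at h2
  simp only [one_pow, Complex.ofReal_one, one_mul, h2] at h1
  exact_mod_cast h1

theorem outcomeProb_add {m : ℕ} (q : Fin m) {U : Matrix (Bits m) (Bits m) ℂ} (hU : Uᴴ * U = 1)
    (x : Bits m) : outcomeProb q (U *ᵥ ket x) 0 + outcomeProb q (U *ᵥ ket x) 1 = 1 := by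
  have h2 := dotProduct_mulVec_of_isometry hU (ket x) (ket x)
  have h3 : star (ket x) ⬝ᵥ ket x = 1 := by simp [ket]
  rw [h3, dotProduct] at h2
  have h4 : ∀ y, star (U *ᵥ ket x) y * (U *ᵥ ket x) y = ((‖(U *ᵥ ket x) y‖ ^ 2 : ℝ) : ℂ) := by
    intro y
    rw [Pi.star_apply, Complex.ofReal_pow, ← Complex.conj_mul']
    rfl
  simp only [h4] at h2
  have h5 : ∑ y, ‖(U *ᵥ ket x) y‖ ^ 2 = 1 := by exact_mod_cast h2
  rw [← h5, ← Finset.sum_filter_add_sum_filter_not Finset.univ (fun y : Bits m => y q = 0)]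
  have h6 : ∀ b : Fin 2, b = 1 ↔ ¬ b = 0 := by decide
  simp only [outcomeProb, h6]

/-- The left side is the expectation of Z. Since XY = iZ, it is the imaginary part of an inner
product of two Majorana images, which the isometry `U` carries back to `ket x`. -/
theorem outcomeProb_sub {m : ℕ} {q : Fin m} (hq : (q : ℕ) = 0)
    {U : Matrix (Bits m) (Bits m) ℂ} (hU : Uᴴ * U = 1) {u v : Fin m → ℂ}
    (hu : Intertwines U (Pi.single q 1) u) (hv : Intertwines U (Pi.single q Complex.I) v)
    (x : Bits m) :
    outcomeProb q (U *ᵥ ket x) 0 - outcomeProb q (U *ᵥ ket x) 1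
      = ∑ i, weight u v i * hat (x i) := by
  have hb : ∀ (b : Fin 2) (z z' : ℂ), (conj (bitConj (b + 1) z) * bitConj (b + 1) z').im
      = (conj z * z').im * hat b := by
    intro b z z'
    fin_cases b <;> (simp [bitConj, hat]; try ring)
  have h1 := dotProduct_majorana_single hq 1 Complex.I (U *ᵥ ket x)
  rw [hu, hv, dotProduct_mulVec_of_isometry hU, dotProduct_majorana_ket] at h1
  have h2 := congrArg Complex.im h1
  simp only [Complex.im_sum, Complex.im_mul_ofReal, hb] at h2
  simp only [weight]
  rw [h2, ← Finset.sum_filter_add_sum_filter_not Finset.univ (fun y : Bits m => y q = 0),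
    sub_eq_add_neg, outcomeProb, outcomeProb, ← Finset.sum_neg_distrib]
  have h6 : ∀ b : Fin 2, b = 1 ↔ ¬ b = 0 := by decide
  simp only [h6]
  congr 1 <;> refine Finset.sum_congr rfl fun y hy => ?_ <;>
    simp only [Finset.mem_filter, Finset.mem_univ, true_and] at hy <;> simp [hat, hy]

theorem outcomeProb_eq {m : ℕ} {q : Fin m} (hq : (q : ℕ) = 0)
    {U : Matrix (Bits m) (Bits m) ℂ} (hU : Uᴴ * U = 1) {u v : Fin m → ℂ}
    (hu : Intertwines U (Pi.single q 1) u) (hv : Intertwines U (Pi.single q Complex.I) v)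
    (x : Bits m) (b : Fin 2) :
    outcomeProb q (U *ᵥ ket x) b = (1 + hat b * ∑ i, weight u v i * hat (x i)) / 2 := by
  have h1 := outcomeProb_add q hU x
  have h2 := outcomeProb_sub hq hU hu hv x
  rw [← h2]
  fin_cases b <;> simp [hat] <;> linarith

theorem sum_abs_weight_le {m : ℕ} {u v : Fin m → ℂ} (hu : ∑ i, ‖u i‖ ^ 2 = 1)
    (hv : ∑ i, ‖v i‖ ^ 2 = 1) : ∑ i, |weight u v i| ≤ 1 := by
  have h : ∀ i, |weight u v i| ≤ (‖u i‖ ^ 2 + ‖v i‖ ^ 2) / 2 := by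
    intro i
    have h1 := Complex.abs_im_le_norm (conj (u i) * v i)
    rw [norm_mul, Complex.norm_conj] at h1
    unfold weight
    nlinarith [sq_nonneg (‖u i‖ - ‖v i‖)]
  refine (Finset.sum_le_sum fun i _ => h i).trans ?_
  rw [← Finset.sum_div, Finset.sum_add_distrib, hu, hv]
  norm_num

theorem sum_mul_hat_pad {n d : ℕ} (W : Fin (n + d) → ℝ) (x : Bits n) :
    ∑ i, W i * hat (pad (n + d) x i)
      = affineForm (fun i => W (Fin.castAdd d i)) (∑ i, W (Fin.natAdd n i)) x := by
  rw [Fin.sum_univ_add]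
  simp [affineForm, pad, hat]

/-- A computable function is represented with margin `2p - 1` by weights of 1-norm at most 1. -/
theorem IsMatchgateComputable.exists_affineForm {n : ℕ} [NeZero n] {f : Bits n → Fin 2} {p : ℝ}
    (hf : IsMatchgateComputable f p) :
    ∃ (w : Fin n → ℝ) (θ : ℝ), (∑ i, |w i|) + |θ| ≤ 1 ∧
      ∀ x, 2 * p - 1 ≤ hat (f x) * affineForm w θ x := by
  obtain ⟨m, h, U, hU, hc⟩ := hf
  obtain ⟨d, rfl⟩ := Nat.exists_eq_add_of_le h
  have hq : ((Fin.castLE h (0 : Fin n) : Fin (n + d)) : ℕ) = 0 := by simp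
  obtain ⟨u, hu⟩ := hU.exists_intertwines (Pi.single (Fin.castLE h (0 : Fin n)) 1)
  obtain ⟨v, hv⟩ := hU.exists_intertwines (Pi.single (Fin.castLE h (0 : Fin n)) Complex.I)
  have hUU := hU.conjTranspose_mul_self
  have hw := sum_abs_weight_le (sum_norm_sq_of_intertwines hq hUU (by simp) hu)
    (sum_norm_sq_of_intertwines hq hUU (by simp) hv)
  refine ⟨fun i => weight u v (Fin.castAdd d i), ∑ i, weight u v (Fin.natAdd n i), ?_, ?_⟩
  · rw [Fin.sum_univ_add] at hw
    -- Merging the ancilla weights into one θ can only lower the 1-norm.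
    exact (add_le_add_right (Finset.abs_sum_le_sum_abs _ _) _).trans hw
  · intro x
    have h1 := hc x
    rw [outcomeProb_eq hq hUU hu hv, sum_mul_hat_pad] at h1
    linarith

/-! ### Margins -/

theorem abs_hat (b : Fin 2) : |hat b| = 1 := by
  unfold hat; split_ifs <;> simp

theorem IsRepresentation.hat_mul {n : ℕ} {f : Bits n → Fin 2} {w : Fin n → ℝ} {θ : ℝ}
    (h : IsRepresentation f w θ) (x : Bits n) :
    hat (f x) * affineForm w θ x = |affineForm w θ x| := by
  have := h x
  by_cases h0 : f x = 0
  · rw [abs_of_pos (this.1 h0)]; simp [hat, h0]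
  · have h1 : affineForm w θ x ≤ 0 := not_lt.1 fun h' => h0 (this.2 h')
    rw [abs_of_nonpos h1]; simp [hat, h0]

theorem isRepresentation_of_pos {n : ℕ} {f : Bits n → Fin 2} {w : Fin n → ℝ} {θ : ℝ}
    (h : ∀ x, 0 < hat (f x) * affineForm w θ x) : IsRepresentation f w θ := by
  intro x
  have hx := h x
  by_cases h0 : f x = 0
  · simpa [hat, h0] using hx
  · simp only [h0, false_iff, not_lt]
    simp [hat, h0] at hx
    exact hx.le

/-- The minimum of the signed affine form. -/
noncomputable def signedMargin {n : ℕ} (f : Bits n → Fin 2) (q : (Fin n → ℝ) × ℝ) : ℝ :=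
  Finset.univ.inf' Finset.univ_nonempty fun x : Bits n => hat (f x) * affineForm q.1 q.2 x

/-- This lets the margin be maximized over all normalized pairs, a compact set, instead of over
representations only. -/
theorem IsRepresentation.repMargin_eq {n : ℕ} {f : Bits n → Fin 2} {w : Fin n → ℝ} {θ : ℝ}
    (h : IsRepresentation f w θ) : repMargin w θ = signedMargin f (w, θ) := by
  simp only [repMargin, signedMargin, h.hat_mul]

theorem continuous_signedMargin {n : ℕ} (f : Bits n → Fin 2) : Continuous (signedMargin f) := by
  unfold signedMargin
  apply Continuous.finset_inf'_apply
  intro x _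
  unfold affineForm
  fun_prop

theorem isCompact_normalized (n : ℕ) :
    IsCompact {q : (Fin n → ℝ) × ℝ | IsNormalized q.1 q.2} := by
  refine Metric.isCompact_of_isClosed_isBounded ?_ ?_
  · unfold IsNormalized
    exact isClosed_eq (by fun_prop) continuous_const
  · refine (Metric.isBounded_closedBall (x := 0) (r := 1)).subset ?_
    rintro ⟨w, θ⟩ h
    simp only [IsNormalized, Set.mem_ofPred_eq] at h
    rw [mem_closedBall_zero_iff, Prod.norm_def]
    have h0 : 0 ≤ ∑ i, |w i| := Finset.sum_nonneg fun i _ => abs_nonneg _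
    refine max_le ((pi_norm_le_iff_of_nonneg zero_le_one).2 fun i => ?_) ?_
    · have := Finset.single_le_sum (f := fun i => |w i|) (fun i _ => abs_nonneg _)
        (Finset.mem_univ i)
      rw [Real.norm_eq_abs]
      linarith [abs_nonneg θ]
    · simp only [Real.norm_eq_abs]
      linarith

theorem abs_affineForm_le {n : ℕ} (w : Fin n → ℝ) (θ : ℝ) (x : Bits n) :
    |affineForm w θ x| ≤ (∑ i, |w i|) + |θ| := by
  refine (abs_add_le _ _).trans (add_le_add_left ?_ _)
  refine (Finset.abs_sum_le_sum_abs _ _).trans (le_of_eq ?_)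
  simp [abs_mul, abs_hat]

theorem affineForm_div {n : ℕ} (w : Fin n → ℝ) (θ N : ℝ) (x : Bits n) :
    affineForm (fun i => w i / N) (θ / N) x = affineForm w θ x / N := by
  simp only [affineForm, add_div, Finset.sum_div, div_mul_eq_mul_div]

theorem exists_isMargin {n : ℕ} {f : Bits n → Fin 2} {δ : ℝ} (hδ : 0 < δ) {w : Fin n → ℝ} {θ : ℝ}
    (hN : (∑ i, |w i|) + |θ| ≤ 1) (h : ∀ x, δ ≤ hat (f x) * affineForm w θ x) :
    IsLTG f ∧ ∃ ε, IsMargin f ε ∧ δ ≤ ε := by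
  refine ⟨⟨w, θ, isRepresentation_of_pos fun x => hδ.trans_le (h x)⟩, ?_⟩
  set N := (∑ i, |w i|) + |θ| with hNdef
  have hN0 : 0 < N := by
    refine hδ.trans_le ((h 0).trans ?_)
    refine (le_abs_self _).trans ?_
    rw [abs_mul, abs_hat, one_mul]
    exact abs_affineForm_le w θ 0
  have hmem : IsNormalized (fun i => w i / N) (θ / N) := by
    simp only [IsNormalized, abs_div, abs_of_pos hN0]
    rw [← Finset.sum_div, ← add_div, ← hNdef, div_self hN0.ne']
  have hmar : δ ≤ signedMargin f (fun i => w i / N, θ / N) := by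
    refine Finset.le_inf' _ _ fun x _ => ?_
    -- As `N ≤ 1`, normalizing can only increase the margin.
    rw [affineForm_div, ← mul_div_assoc, le_div_iff₀ hN0]
    exact (mul_le_of_le_one_right hδ.le hN).trans (h x)
  obtain ⟨⟨w₀, θ₀⟩, h0, hmax⟩ := (isCompact_normalized n).exists_isMaxOn
    ⟨(fun i => w i / N, θ / N), hmem⟩
    (continuous_signedMargin f).continuousOn
  have hδ0 : δ ≤ signedMargin f (w₀, θ₀) := hmar.trans (hmax (a := (fun i => w i / N, θ / N)) hmem)
  -- The maximizer represents `f` because its signed margin is at least `δ > 0`.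
  have hrep : IsRepresentation f w₀ θ₀ := isRepresentation_of_pos fun x =>
    (hδ.trans_le hδ0).trans_le (Finset.inf'_le _ (Finset.mem_univ x))
  refine ⟨_, ⟨⟨w₀, θ₀, hrep, h0, hrep.repMargin_eq.symm⟩, ?_⟩, hδ0⟩
  rintro _ ⟨w₁, θ₁, hrep₁, hnorm₁, rfl⟩
  rw [hrep₁.repMargin_eq]
  exact hmax (a := (w₁, θ₁)) hnorm₁

/-! ### Circuits for threshold gates -/

theorem rotation_mem_SU {c s : ℝ} (h : c ^ 2 + s ^ 2 = 1) :
    (!![(c : ℂ), -s; s, c] : Matrix (Fin 2) (Fin 2) ℂ) ∈ Matrix.specialUnitaryGroup (Fin 2) ℂ := by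
  have h' : (c : ℂ) ^ 2 + (s : ℂ) ^ 2 = 1 := by exact_mod_cast h
  rw [Matrix.mem_specialUnitaryGroup_iff, Matrix.mem_unitaryGroup_iff']
  refine ⟨?_, ?_⟩
  · ext i l
    fin_cases i <;> fin_cases l <;> simp [Matrix.mul_apply, Fin.sum_univ_two] <;>
      first | ring1 | linear_combination h'
  · rw [Matrix.det_fin_two]
    simp
    linear_combination h'

theorem flipGate_mem_SU :
    (!![0, Complex.I; Complex.I, 0] : Matrix (Fin 2) (Fin 2) ℂ)
      ∈ Matrix.specialUnitaryGroup (Fin 2) ℂ := by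
  rw [Matrix.mem_specialUnitaryGroup_iff, Matrix.mem_unitaryGroup_iff']
  refine ⟨?_, ?_⟩
  · ext i l
    fin_cases i <;> fin_cases l <;> simp [Matrix.mul_apply, Fin.sum_univ_two]
  · rw [Matrix.det_fin_two]
    simp

theorem isMatchgateCircuit_gate {m : ℕ} {j k : Fin m} (hk : (k : ℕ) = j + 1)
    {A B : Matrix (Fin 2) (Fin 2) ℂ} (hA : A ∈ Matrix.specialUnitaryGroup (Fin 2) ℂ)
    (hB : B ∈ Matrix.specialUnitaryGroup (Fin 2) ℂ) :
    IsMatchgateCircuit (applyOn j k (gate A B)) :=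
  Submonoid.subset_closure ⟨j, k, A, B, hk, hA, hB, rfl⟩

/-- Rotating the odd-parity space spreads the `j`-th coefficient over `j` and `k`. -/
theorem intertwines_rotation_odd {m : ℕ} {j k : Fin m} (hk : (k : ℕ) = j + 1) {c s : ℝ}
    (h : c ^ 2 + s ^ 2 = 1) {z z' : Fin m → ℂ} (hz : ∀ i, i ≠ j → i ≠ k → z' i = z i)
    (hzk : z k = 0) (hj' : z' j = c * z j) (hk' : z' k = s * z j) :
    Intertwines (applyOn j k (gate 1 !![(c : ℂ), -s; s, c])) z z' := by
  refine intertwines_gate_of_eq hk (by simp)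
    (conjTranspose_mul_self_of_mem_SU (rotation_mem_SU h)) hz ?_
  rw [hj', hk', hzk]
  ext i l
  fin_cases i <;> fin_cases l <;> simp [oddBlock, Matrix.mul_apply, Fin.sum_univ_two] <;> ring

/-- Rotating the even-parity space spreads the `j`-th coefficient over `j` and `k`,
with a complex conjugation. -/
theorem intertwines_rotation_even {m : ℕ} {j k : Fin m} (hk : (k : ℕ) = j + 1) {c s : ℝ}
    (h : c ^ 2 + s ^ 2 = 1) {z z' : Fin m → ℂ} (hz : ∀ i, i ≠ j → i ≠ k → z' i = z i)
    (hzk : z k = 0) (hj' : z' j = c * z j) (hk' : z' k = s * conj (z j)) :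
    Intertwines (applyOn j k (gate !![(c : ℂ), -s; s, c] 1)) z z' := by
  refine intertwines_gate_of_eq hk (conjTranspose_mul_self_of_mem_SU (rotation_mem_SU h))
    (by simp) hz ?_
  rw [hj', hk', hzk]
  ext i l
  fin_cases i <;> fin_cases l <;> simp [oddBlock, Matrix.mul_apply, Fin.sum_univ_two]

/-- This gate is i X⊗X, whose conjugation fixes X and negates Y on qubit `j`; the factor i gives the
blocks determinant one. -/
theorem intertwines_flipGate {m : ℕ} {j k : Fin m} (hk : (k : ℕ) = j + 1) (a : ℂ) :
    Intertwines (applyOn j k (gate !![0, Complex.I; Complex.I, 0] !![0, Complex.I; Complex.I, 0]))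
      (Pi.single j a) (Pi.single j (conj a)) := by
  have hjk : k ≠ j := by rintro rfl; omega
  refine intertwines_gate_of_eq hk (conjTranspose_mul_self_of_mem_SU flipGate_mem_SU)
    (conjTranspose_mul_self_of_mem_SU flipGate_mem_SU) ?_ ?_
  · intro i h1 _; simp [h1]
  · ext i l
    fin_cases i <;> fin_cases l <;>
      simp [oddBlock, Matrix.mul_apply, Fin.sum_univ_two, hjk, mul_right_comm _ a,
        mul_right_comm _ (conj a)]

theorem exists_polar {a b : ℝ} (ha : 0 ≤ a) :
    ∃ c s : ℝ, c ^ 2 + s ^ 2 = 1 ∧ c * √(a ^ 2 + b ^ 2) = a ∧ s * √(a ^ 2 + b ^ 2) = b := by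
  by_cases h : a ^ 2 + b ^ 2 = 0
  · have h1 : a = 0 := by nlinarith [sq_nonneg a, sq_nonneg b]
    have h2 : b = 0 := by nlinarith [sq_nonneg a, sq_nonneg b]
    exact ⟨1, 0, by simp [h1, h2]⟩
  · have h0 : 0 < a ^ 2 + b ^ 2 := lt_of_le_of_ne (by positivity) (Ne.symm h)
    have h1 := Real.sqrt_pos.2 h0
    refine ⟨a / √(a ^ 2 + b ^ 2), b / √(a ^ 2 + b ^ 2), ?_, ?_, ?_⟩
    · rw [div_pow, div_pow, ← add_div, Real.sq_sqrt h0.le, div_self h]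
    · field_simp
    · field_simp

/-- Every unit vector of nonnegative amplitudes, with any choice of signs, is realized by a
circuit on at least two qubits. -/
theorem exists_circuit {d : ℕ} (hd : 1 ≤ d) {σ : Fin (d + 1) → ℝ}
    (hσ : ∀ i, σ i = 1 ∨ σ i = -1) (t : ℕ) (ht : t < d + 1) (a : Fin (d + 1) → ℝ)
    (ha : ∀ i, 0 ≤ a i) (hsum : ∑ i, a i ^ 2 = 1)
    (hsupp : ∀ i : Fin (d + 1), t < (i : ℕ) → a i = 0) :
    ∃ U, IsMatchgateCircuit U ∧ Intertwines U (Pi.single 0 1) (fun i => (a i : ℂ)) ∧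
      Intertwines U (Pi.single 0 Complex.I) (fun i => σ i * a i * Complex.I) := by
  induction t generalizing a with
  | zero =>
    have h0 : ∀ i, i ≠ 0 → a i = 0 := fun i hi =>
      hsupp i (Nat.pos_of_ne_zero fun h => hi (Fin.ext h))
    have h1 : a 0 = 1 := by
      rw [Finset.sum_eq_single 0 (fun i _ hi => by simp [h0 i hi]) (by simp)] at hsum
      nlinarith [ha 0]
    have e1 : (fun i => (a i : ℂ)) = Pi.single 0 1 := by
      ext1 i
      by_cases hi : i = 0
      · subst hi; simp [h1]
      · simp [hi, h0 i hi]
    have e2 : (fun i => σ i * a i * Complex.I) = Pi.single 0 (σ 0 * Complex.I) := by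
      ext1 i
      by_cases hi : i = 0
      · subst hi; simp [h1]
      · simp [hi, h0 i hi]
    rw [e1, e2]
    rcases hσ 0 with h | h
    · exact ⟨1, Submonoid.one_mem _, Intertwines.one _, by simpa [h] using Intertwines.one _⟩
    -- A negative sign at site 0 needs a gate, hence a second qubit; `1 ≤ d` provides it.
    · have hk : ((⟨1, by omega⟩ : Fin (d + 1)) : ℕ) = (0 : Fin (d + 1)) + 1 := by simp
      refine ⟨_, isMatchgateCircuit_gate hk flipGate_mem_SU flipGate_mem_SU, ?_, ?_⟩
      · simpa using intertwines_flipGate hk 1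
      · simpa [h] using intertwines_flipGate hk Complex.I
  | succ t ih =>
    set j : Fin (d + 1) := ⟨t, by omega⟩ with hj
    set k : Fin (d + 1) := ⟨t + 1, ht⟩ with hk
    have hjk : j ≠ k := by simp [hj, hk]
    have hadj : (k : ℕ) = j + 1 := rfl
    obtain ⟨c, s, hcs, hc, hs⟩ := exists_polar (b := a k) (ha j)
    set r := √(a j ^ 2 + a k ^ 2) with hr
    have hr2 : r ^ 2 = a j ^ 2 + a k ^ 2 := Real.sq_sqrt (by positivity)
    -- Merge the amplitude at `k` into `j`, keeping the norm; one rotation by the angle of `(a j, a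
    -- k)` undoes this.
    set a' := Function.update (Function.update a j r) k 0 with ha'
    have a'j : a' j = r := by simp [ha', hjk]
    have a'k : a' k = 0 := by simp [ha']
    have a'o : ∀ i, i ≠ j → i ≠ k → a' i = a i := by
      intro i h1 h2; simp [ha', h1, h2]
    obtain ⟨U, hU, h1, h2⟩ := ih (by omega) a' (by
        intro i
        by_cases hij : i = j
        · rw [hij, a'j]; positivity
        · by_cases hik : i = k
          · rw [hik, a'k]
          · rw [a'o i hij hik]; exact ha i) (by
        have split : ∀ g : Fin (d + 1) → ℝ,
            ∑ i, g i = g j + g k + ∑ i ∈ (Finset.univ.erase j).erase k, g i := by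
          intro g
          rw [← Finset.add_sum_erase _ _ (Finset.mem_univ j),
            ← Finset.add_sum_erase _ _ (Finset.mem_erase.2 ⟨hjk.symm, Finset.mem_univ k⟩),
            add_assoc]
        rw [← hsum, split, split (fun i => a i ^ 2), a'j, a'k, hr2]
        congr 1
        · ring
        · refine Finset.sum_congr rfl fun i hi => ?_
          simp only [Finset.mem_erase, Finset.mem_univ, and_true] at hi
          rw [a'o i hi.2 hi.1]) (by
        intro i hi
        by_cases hik : i = k
        · rw [hik, a'k]
        · have hik' : (i : ℕ) ≠ t + 1 := fun h => hik (Fin.ext h)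
          have hij : i ≠ j := by
            rintro rfl
            simp [hj] at hi
          rw [a'o i hij hik]
          exact hsupp i (by omega))
    have hc' : (c : ℂ) * r = a j := by exact_mod_cast hc
    have hs' : (s : ℂ) * r = a k := by exact_mod_cast hs
    have hone : (1 : Matrix (Fin 2) (Fin 2) ℂ) ∈ Matrix.specialUnitaryGroup (Fin 2) ℂ :=
      Submonoid.one_mem _
    -- Conjugation fixes real amplitudes and negates imaginary ones, so the even rotation flips the
    -- sign passed to `k` and the odd one keeps it.
    by_cases hsign : σ k = σ j
    · refine ⟨_, Submonoid.mul_mem _ hU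
        (isMatchgateCircuit_gate hadj hone (rotation_mem_SU hcs)),
        h1.mul (intertwines_rotation_odd hadj hcs ?_ ?_ ?_ ?_),
        h2.mul (intertwines_rotation_odd hadj hcs ?_ ?_ ?_ ?_)⟩
      · intro i hi hi'; simp only [a'o i hi hi']
      · simp [a'k]
      · simp only [a'j, hc']
      · simp only [a'j, hs']
      · intro i hi hi'; simp only [a'o i hi hi']
      · simp [a'k]
      · simp only [a'j, ← hc']; ring
      · simp only [a'j, ← hs', hsign]; ring
    · have hsign' : σ k = -σ j := by
        rcases hσ k with h | h <;> rcases hσ j with h' | h' <;> simp_all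
      refine ⟨_, Submonoid.mul_mem _ hU
        (isMatchgateCircuit_gate hadj (rotation_mem_SU hcs) hone),
        h1.mul (intertwines_rotation_even hadj hcs ?_ ?_ ?_ ?_),
        h2.mul (intertwines_rotation_even hadj hcs ?_ ?_ ?_ ?_)⟩
      · intro i hi hi'; simp only [a'o i hi hi']
      · simp [a'k]
      · simp only [a'j, hc']
      · simp only [a'j, Complex.conj_ofReal, hs']
      · intro i hi hi'; simp only [a'o i hi hi']
      · simp [a'k]
      · simp only [a'j, ← hc']; ring
      · simp only [a'j, ← hs', hsign', map_mul, Complex.conj_ofReal, Complex.conj_I]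
        push_cast; ring

/-- Every weight vector of 1-norm one is realized by a circuit on at least two qubits. -/
theorem exists_circuit_weight {d : ℕ} (hd : 1 ≤ d) (W : Fin (d + 1) → ℝ)
    (hW : ∑ i, |W i| = 1) :
    ∃ U, IsMatchgateCircuit U ∧ ∃ u v, Intertwines U (Pi.single 0 1) u ∧
      Intertwines U (Pi.single 0 Complex.I) v ∧ weight u v = W := by
  set σ : Fin (d + 1) → ℝ := fun i => if 0 ≤ W i then 1 else -1 with hσ
  have h : ∀ i, σ i = 1 ∨ σ i = -1 := by
    intro i; simp only [hσ]; split_ifs <;> simp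
  obtain ⟨U, hU, h1, h2⟩ := exists_circuit hd h d (Nat.lt_succ_self d) (fun i => √|W i|)
    (fun i => Real.sqrt_nonneg _) (by simpa [Real.sq_sqrt] using hW)
    (fun i hi => absurd i.2 (by omega))
  refine ⟨U, hU, _, _, h1, h2, ?_⟩
  ext1 i
  have h3 : √|W i| * √|W i| = |W i| := Real.mul_self_sqrt (abs_nonneg _)
  have h4 : weight (fun i => ((√|W i| : ℝ) : ℂ)) (fun i => σ i * (√|W i| : ℝ) * Complex.I) i
      = σ i * (√|W i| * √|W i|) := by
    have : conj ((√|W i| : ℝ) : ℂ) * (σ i * (√|W i| : ℝ) * Complex.I)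
        = ((σ i * (√|W i| * √|W i|) : ℝ) : ℂ) * Complex.I := by
      rw [Complex.conj_ofReal]; push_cast; ring
    rw [weight, this, Complex.im_ofReal_mul, Complex.I_im, mul_one]
  rw [h4, h3]
  simp only [hσ]
  split_ifs with h5
  · rw [one_mul, abs_of_nonneg h5]
  · rw [abs_of_neg (not_le.1 h5)]; ring

theorem exists_circuit_of_isMargin {n : ℕ} [NeZero n] {f : Bits n → Fin 2} {p ε : ℝ}
    (hε : IsMargin f ε) (hp : 2 * p - 1 ≤ ε) :
    ∃ U : Matrix (Bits (n + 1)) (Bits (n + 1)) ℂ,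
      IsMatchgateCircuit U ∧ Computes (Nat.le_succ n) U f p := by
  obtain ⟨w, θ, hrep, hnorm, rfl⟩ := hε.1
  have hn : 1 ≤ n := Nat.one_le_iff_ne_zero.2 (NeZero.ne n)
  -- The last qubit is an ancilla in state 0, where `hat` is 1, so its weight acts as the constant
  -- θ.
  set W : Fin (n + 1) → ℝ := Fin.snoc w θ with hWdef
  have e1 : ∀ i : Fin n, W (Fin.castAdd 1 i) = w i := fun i => Fin.snoc_castSucc (α := fun _ => ℝ) θ w i
  have e2 : ∀ i : Fin 1, W (Fin.natAdd n i) = θ := fun i => by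
    fin_cases i
    exact Fin.snoc_last (α := fun _ => ℝ) θ w
  obtain ⟨U, hU, u, v, hu, hv, hw⟩ := exists_circuit_weight hn W (by
    rw [Fin.sum_univ_add]
    simp only [e1, e2, Fin.sum_univ_one]
    exact hnorm)
  refine ⟨U, hU, fun x => ?_⟩
  have hq : Fin.castLE (Nat.le_succ n) (0 : Fin n) = 0 := by ext; simp
  rw [hq, outcomeProb_eq rfl hU.conjTranspose_mul_self hu hv, hw, sum_mul_hat_pad]
  simp only [e1, e2, Fin.sum_univ_one]
  rw [hrep.hat_mul]
  have : repMargin w θ ≤ |affineForm w θ x| := Finset.inf'_le _ (Finset.mem_univ x)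
  linarith

end Matchgate

theorem theorem1 (n : ℕ) [NeZero n] (f : Matchgate.Bits n → Fin 2) (p : ℝ)
    (hp : 1 / 2 < p) (hp1 : p ≤ 1) :
    (Matchgate.IsMatchgateComputable f p ↔
      Matchgate.IsLTG f ∧ ∃ ε : ℝ, Matchgate.IsMargin f ε ∧ 2 * p - 1 ≤ ε) ∧
    (Matchgate.IsMatchgateComputable f p ↔
      ∃ (m : ℕ) (h : n ≤ m) (U : Matrix (Matchgate.Bits m) (Matchgate.Bits m) ℂ),
        m ≤ n + 1 ∧ Matchgate.IsMatchgateCircuit U ∧ Matchgate.Computes h U f p) := by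
  have hab : Matchgate.IsMatchgateComputable f p →
      Matchgate.IsLTG f ∧ ∃ ε : ℝ, Matchgate.IsMargin f ε ∧ 2 * p - 1 ≤ ε := by
    intro h
    obtain ⟨w, θ, hN, h⟩ := h.exists_affineForm
    exact Matchgate.exists_isMargin (by linarith) hN h
  refine ⟨⟨hab, ?_⟩, ?_, ?_⟩
  · rintro ⟨_, ε, hε, h⟩
    obtain ⟨U, hU, hc⟩ := Matchgate.exists_circuit_of_isMargin hε h
    exact ⟨n + 1, Nat.le_succ n, U, hU, hc⟩
  · intro h
    obtain ⟨_, ε, hε, h⟩ := hab h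
    obtain ⟨U, hU, hc⟩ := Matchgate.exists_circuit_of_isMargin hε h
    exact ⟨n + 1, Nat.le_succ n, U, le_rfl, hU, hc⟩
  · rintro ⟨m, h, U, _, hU, hc⟩
    exact ⟨m, h, U, hU, hc⟩
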